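/- Let $m$ and $n$ be odd primes, not necessarily distinct, and let $q$ be a power of an odd prime. Then the word map $$SL_2(\mathbb F_q)\times SL_2(\mathbb F_q)\to SL_2(\mathbb F_q),\qquad (g_1,g_2)\mapsto g_1^m g_2^n$$ attached to the word $X_1^mX_2^n$ is surjective if and only if $(m,n,q)\neq(3,3,3)$. Moreover, the set of cubes $\{x^3 : x\in SL_2(\mathbb F_3)\}$ is a subgroup of $SL_2(\mathbb F_3)$ of order $8$, isomorphic to the quaternion group $Q_8$. -/

import Mathlib

/-- The word map `G^α → G` attached to a word `w` in the free group on `α`: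
the tuple `g` is sent to the value of `w` at `g`. -/
def wordMap {α : Type*} (w : FreeGroup α) (G : Type*) [Group G] : (α → G) → G :=
  fun g => FreeGroup.lift g w

/-- The word `X₁ ^ m * X₂ ^ n` in the free group on the two letters `X₁ = of 0` and `X₂ = of 1`. -/
def powerWord (m n : ℕ) : FreeGroup (Fin 2) :=
  FreeGroup.of 0 ^ m * FreeGroup.of 1 ^ n

/-! Automorphisms preserve powers, and a non-central element is `GL₂`-conjugate to the companion
matrix of its trace `c`, so it suffices to factor that matrix. Trace `0` forces square `-1`, hence
roots of every odd order. If `c ^ 2 ≠ 4`, a nondegenerate conic over the finite field has a point,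
giving two factors of trace `0`. If `c ^ 2 = 4`, the order divides `2p`, so the element is itself an
`m`-th or `n`-th power unless `m = n = p`; in that case the factors have traces `0` and `b`, with `b
≠ 0, 2, -2`, and the second is a `p`-th power. Such `b` exists unless `q = 3`, where the cubes form
a proper subgroup `Q₈`, which is closed under products. -/

open Matrix Polynomial

section SpecialLinearGroupTwo

variable {F : Type*} [Field F]

/-- Conjugation by an invertible matrix, as an automorphism of the special linear group. -/
def glConj (P : GL (Fin 2) F) : SpecialLinearGroup (Fin 2) F ≃* SpecialLinearGroup (Fin 2) F where
  toFun x := ⟨P.1 * x.1 * P.2, by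
    rw [det_mul, det_mul, x.2, mul_one, ← det_mul, Units.inv_eq_val_inv, Units.mul_inv, det_one]⟩
  invFun x := ⟨P.2 * x.1 * P.1, by
    rw [det_mul, det_mul, x.2, mul_one, ← det_mul, Units.inv_eq_val_inv, Units.inv_mul, det_one]⟩
  left_inv x := by
    refine Subtype.ext ?_
    simp only [← mul_assoc, Units.inv_eq_val_inv, Units.inv_mul, one_mul]
    rw [mul_assoc, Units.inv_mul, mul_one]
  right_inv x := by
    refine Subtype.ext ?_
    simp only [← mul_assoc, Units.inv_eq_val_inv, Units.mul_inv, one_mul]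
    rw [mul_assoc, Units.mul_inv, mul_one]
  map_mul' x y := by
    refine Subtype.ext ?_
    change P.1 * (x.1 * y.1) * P.2 = P.1 * x.1 * P.2 * (P.1 * y.1 * P.2)
    simp only [Units.inv_eq_val_inv, mul_assoc, Units.inv_mul_cancel_left]

/-- The companion matrix of `X ^ 2 - c * X + 1`. -/
def companionSL (c : F) : SpecialLinearGroup (Fin 2) F :=
  ⟨!![0, -1; 1, c], by simp [det_fin_two_of]⟩

lemma trace_companionSL (c : F) : (companionSL c).1.trace = c := by
  simp [companionSL, trace_fin_two]

lemma SL_two_sq_eq (g : SpecialLinearGroup (Fin 2) F) :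
    g.1 * g.1 = g.1.trace • g.1 - 1 := by
  have h := g.2
  rw [det_fin_two] at h
  ext i j
  fin_cases i <;> fin_cases j <;>
    simp [mul_apply, trace_fin_two, Fin.sum_univ_two] <;> first | ring1 | linear_combination -h

/-- A non-central element with a cyclic vector `(s, t)` is conjugate to a companion matrix. -/
lemma exists_glConj_of_cyclic (g : SpecialLinearGroup (Fin 2) F) (s t : F)
    (h : s * (g.1 1 0 * s + g.1 1 1 * t) - (g.1 0 0 * s + g.1 0 1 * t) * t ≠ 0) :
    ∃ f : SpecialLinearGroup (Fin 2) F ≃* SpecialLinearGroup (Fin 2) F,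
      f (companionSL g.1.trace) = g := by
  have hg := g.2
  rw [det_fin_two] at hg
  -- The columns are `v = (s, t)` and `g v`; Cayley–Hamilton gives `g² v = tr(g) g v - v`.
  let M : Matrix (Fin 2) (Fin 2) F :=
    !![s, g.1 0 0 * s + g.1 0 1 * t; t, g.1 1 0 * s + g.1 1 1 * t]
  have hM : M.det ≠ 0 := by
    rw [det_fin_two_of]
    exact h
  let P : GL (Fin 2) F := GeneralLinearGroup.mkOfDetNeZero M hM
  refine ⟨glConj P, ?_⟩
  have key : M * (companionSL g.1.trace).1 = g.1 * M := by
    ext i j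
    fin_cases i <;> fin_cases j <;>
      simp [M, companionSL, mul_apply, trace_fin_two, Fin.sum_univ_two]
    · linear_combination s * hg
    · linear_combination t * hg
  refine Subtype.ext ?_
  change M * (companionSL g.1.trace).1 * P.2 = g.1
  rw [key, mul_assoc]
  change g.1 * (P.1 * P.2) = g.1
  rw [Units.inv_eq_val_inv, Units.mul_inv, mul_one]

/-- If `e₁`, `e₂` and `e₁ + e₂` are all eigenvectors, `g` is scalar; otherwise one of them is
cyclic. -/
lemma eq_one_or_neg_one_or_exists_companion (g : SpecialLinearGroup (Fin 2) F) :
    g = 1 ∨ g = -1 ∨ ∃ f : SpecialLinearGroup (Fin 2) F ≃* SpecialLinearGroup (Fin 2) F,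
      f (companionSL g.1.trace) = g := by
  by_cases h10 : g.1 1 0 = 0
  · by_cases h01 : g.1 0 1 = 0
    · by_cases hd : g.1 0 0 = g.1 1 1
      · have hg := g.2
        rw [det_fin_two, h10, h01, ← hd, mul_zero, sub_zero] at hg
        rcases mul_self_eq_one_iff.mp hg with h | h
        · left
          ext i j
          fin_cases i <;> fin_cases j <;> simp [h10, h01, ← hd, h]
        · right; left
          ext i j
          fin_cases i <;> fin_cases j <;> simp [h10, h01, ← hd, h]
      · right; right
        refine exists_glConj_of_cyclic g 1 1 fun h => hd ?_
        rw [h10, h01] at h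
        linear_combination -h
    · right; right
      refine exists_glConj_of_cyclic g 0 1 fun h => h01 ?_
      linear_combination -h
  · right; right
    refine exists_glConj_of_cyclic g 1 0 fun h => h10 ?_
    linear_combination h

/-- A solution of the trace equation yields a factorization of the companion matrix into
an element of trace `0` and an element of trace `b`. -/
lemma exists_mul_eq_companionSL {c b x z : F} (h : x ^ 2 + c * x * z + z ^ 2 + 1 = b * z) :
    ∃ A B : SpecialLinearGroup (Fin 2) F,
      A * B = companionSL c ∧ A.1.trace = 0 ∧ B.1.trace = b := by
  -- Here `B = A⁻¹ C` with `A⁻¹ = -A`. The upper right entry of `A` is fixed by `tr B = b`, and `det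
  -- A = 1` is then the hypothesis.
  refine ⟨⟨!![x, z + x * c - b; z, -x], ?_⟩,
    ⟨!![-(z + x * c - b), x - (z + x * c - b) * c; x, z + x * c], ?_⟩, ?_, ?_, ?_⟩
  · rw [det_fin_two_of]; linear_combination -h
  · rw [det_fin_two_of]; linear_combination -h
  · refine Subtype.ext ?_
    change !![x, z + x * c - b; z, -x] *
      !![-(z + x * c - b), x - (z + x * c - b) * c; x, z + x * c] = !![0, -1; 1, c]
    ext i j
    fin_cases i <;> fin_cases j <;> simp [mul_apply, Fin.sum_univ_two]
    · ring
    · linear_combination h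
    · linear_combination -h
    · linear_combination (-c) * h
  · simp [trace_fin_two]
  · simp [trace_fin_two]

lemma exists_pow_eq_of_trace_eq_zero {g : SpecialLinearGroup (Fin 2) F} (hg : g.1.trace = 0)
    {m : ℕ} (hm : Odd m) : ∃ x, x ^ m = g := by
  have h2 : g ^ 2 = -1 := by
    refine Subtype.ext ?_
    rw [pow_two]
    change g.1 * g.1 = -1
    rw [SL_two_sq_eq, hg, zero_smul, zero_sub]
  obtain ⟨k, rfl⟩ := hm
  have hk : g ^ (2 * k + 1) = (-1) ^ k * g := by rw [pow_succ, pow_mul, h2]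
  rcases k.even_or_odd with he | ho
  · exact ⟨g, by rw [hk, he.neg_one_pow, one_mul]⟩
  · refine ⟨-g, ?_⟩
    rw [Odd.neg_pow ⟨k, rfl⟩, hk, ho.neg_one_pow, neg_one_mul, neg_neg]

lemma exists_pow_eq_of_trace_sq_eq_four {p : ℕ} [Fact p.Prime] [CharP F p]
    {g : SpecialLinearGroup (Fin 2) F} (hg : g.1.trace ^ 2 = 4) {m : ℕ} (hm : m.Prime)
    (hodd : Odd m) (hmp : m ≠ p) : ∃ x, x ^ m = g := by
  have hp : p.Prime := Fact.out
  have hN : g.1 ^ 2 - 1 = g.1.trace • g.1 - 2 := by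
    rw [pow_two, SL_two_sq_eq, sub_sub, one_add_one_eq_two]
  -- The eigenvalues are all `1` or all `-1`, so `g ^ 2` is unipotent and Frobenius kills `g ^ 2 -
  -- 1`.
  have hN2 : (g.1 ^ 2 - 1) ^ 2 = 0 := by
    have hsq : ∀ M : Matrix (Fin 2) (Fin 2) F, (M - 2) ^ 2 = M * M - 4 * M + 4 := fun M => by
      rw [pow_two, sub_mul, mul_sub, mul_sub, (Commute.ofNat_right M 2).eq]
      simp only [← one_add_one_eq_two, ← two_add_two_eq_four, add_mul, mul_add, one_mul, mul_one]
      abel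
    rw [hN, hsq, smul_mul_smul_comm, ← pow_two, SL_two_sq_eq, hg]
    simp only [Algebra.smul_def, map_ofNat, mul_sub, mul_one]
    abel
  have hpow : (g.1 ^ 2) ^ p = 1 := by
    have h := sub_pow_char_of_commute p (Commute.one_right (g.1 ^ 2))
    obtain ⟨r, hr⟩ := Nat.exists_eq_add_of_le hp.two_le
    have h0 : (g.1 ^ 2 - 1) ^ p = 0 := by rw [hr, pow_add, hN2, zero_mul]
    rw [h0, one_pow] at h
    exact sub_eq_zero.mp h.symm
  have hgp : g ^ (2 * p) = 1 := by
    refine Subtype.ext ((Matrix.SpecialLinearGroup.coe_pow g (2 * p)).trans ?_)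
    rw [pow_mul, hpow]
    rfl
  have hc : m.Coprime (2 * p) :=
    Nat.Coprime.mul_right hodd.coprime_two_right ((Nat.coprime_primes hm hp).mpr hmp)
  obtain ⟨k, hk⟩ := exists_pow_eq_self_of_coprime
    (hc.coprime_dvd_right (orderOf_dvd_of_pow_eq_one hgp))
  exact ⟨g ^ k, by rw [← pow_mul, mul_comm, pow_mul, hk]⟩

/-- In characteristic `p`, elements of trace different from `2` and `-2` are `p`-th powers. -/
lemma exists_pow_char_eq_of_trace_sq_ne_four [Finite F] {p : ℕ} [CharP F p]
    {g : SpecialLinearGroup (Fin 2) F} (hg : g.1.trace ^ 2 ≠ 4) : ∃ x, x ^ p = g := by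
  have := Fintype.ofFinite F
  obtain ⟨k, -, hk⟩ := FiniteField.card F p
  -- Equal traces make `g` conjugate to `g ^ q`, which is visibly a `p`-th power.
  have htr : (g ^ Fintype.card F).1.trace = g.1.trace := by
    rw [show (g ^ Fintype.card F).1 = g.1 ^ Fintype.card F from Matrix.SpecialLinearGroup.coe_pow g _,
      FiniteField.trace_pow_card, FiniteField.pow_card]
  have aux : ∀ h : SpecialLinearGroup (Fin 2) F, h.1.trace ^ 2 ≠ 4 →
      ∃ f : SpecialLinearGroup (Fin 2) F ≃* SpecialLinearGroup (Fin 2) F,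
        f (companionSL h.1.trace) = h := by
    intro h hh
    rcases eq_one_or_neg_one_or_exists_companion h with rfl | rfl | hf
    · exact absurd (by norm_num [trace_fin_two]) hh
    · exact absurd (by norm_num [trace_fin_two]) hh
    · exact hf
  obtain ⟨f, hf⟩ := aux g hg
  obtain ⟨f', hf'⟩ := aux (g ^ Fintype.card F) (by rwa [htr])
  rw [htr] at hf'
  obtain ⟨j, hj⟩ := Nat.exists_eq_succ_of_ne_zero k.ne_zero
  refine ⟨f (f'.symm (g ^ p ^ j)), ?_⟩
  rw [← map_pow, ← map_pow, ← pow_mul, ← pow_succ, ← Nat.succ_eq_add_one, ← hj, ← hk, ← hf',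
    MulEquiv.symm_apply_apply, hf]

lemma exists_binary_quadratic_eq_zero [Finite F] (h2 : (2 : F) ≠ 0) {c : F} (hc : c ^ 2 ≠ 4) :
    ∃ x z : F, x ^ 2 + c * x * z + z ^ 2 + 1 = 0 := by
  have := Fintype.ofFinite F
  have h4 : (4 : F) ≠ 0 := by
    have := mul_ne_zero h2 h2
    norm_num at this
    exact this
  have hd : 1 - c ^ 2 / 4 ≠ 0 := by
    intro h
    apply hc
    field_simp at h
    linear_combination -h
  have hodd : Fintype.card F % 2 = 1 :=
    FiniteField.odd_card_of_char_ne_two fun h => h2 <| by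
      have := CharP.cast_eq_zero F (ringChar F)
      rw [h] at this
      exact_mod_cast this
  -- Completing the square with `u = x + c z / 2` gives `u² + 1 + (1 - c² / 4) z² = 0`.
  obtain ⟨u, z, h⟩ := FiniteField.exists_root_sum_quadratic
    (f := C 1 * X ^ 2 + C 0 * X + C 1) (g := C (1 - c ^ 2 / 4) * X ^ 2 + C 0 * X + C 0)
    (degree_quadratic one_ne_zero) (degree_quadratic hd) hodd
  refine ⟨u - c * z / 2, z, ?_⟩
  simp only [eval_add, eval_mul, eval_C, eval_pow, eval_X] at h
  field_simp at h ⊢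
  linear_combination h

lemma exists_pow_mul_pow_eq [Finite F] (h2 : (2 : F) ≠ 0) {m n : ℕ} (hm : m.Prime)
    (hmo : Odd m) (hn : n.Prime) (hno : Odd n) (h3 : ¬(m = 3 ∧ n = 3 ∧ Nat.card F = 3))
    (g : SpecialLinearGroup (Fin 2) F) :
    ∃ x y : SpecialLinearGroup (Fin 2) F, x ^ m * y ^ n = g := by
  rcases eq_one_or_neg_one_or_exists_companion g with rfl | rfl | ⟨f, hf⟩
  · exact ⟨1, 1, by simp⟩
  · exact ⟨-1, 1, by simp [hmo.neg_one_pow]⟩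
  have reduce : (∃ A B : SpecialLinearGroup (Fin 2) F, A * B = companionSL g.1.trace ∧
      (∃ x, x ^ m = A) ∧ ∃ y, y ^ n = B) →
      ∃ x y : SpecialLinearGroup (Fin 2) F, x ^ m * y ^ n = g := by
    rintro ⟨_, _, h, ⟨x, rfl⟩, y, rfl⟩
    exact ⟨f x, f y, by rw [← map_pow, ← map_pow, ← map_mul, h, hf]⟩
  by_cases hc : g.1.trace ^ 2 = 4
  · obtain ⟨p, hchar⟩ := CharP.exists F
    have hp : p.Prime := (CharP.char_is_prime_or_zero F p).resolve_right
      (CharP.char_ne_zero_of_finite F p)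
    have : Fact p.Prime := ⟨hp⟩
    by_cases hmp : m = p
    swap
    · obtain ⟨x, hx⟩ := exists_pow_eq_of_trace_sq_eq_four hc hm hmo hmp
      exact ⟨x, 1, by simp [hx]⟩
    by_cases hnp : n = p
    swap
    · obtain ⟨x, hx⟩ := exists_pow_eq_of_trace_sq_eq_four hc hn hno hnp
      exact ⟨1, x, by simp [hx]⟩
    obtain ⟨b, hb0, hb⟩ : ∃ b : F, b ≠ 0 ∧ b ^ 2 ≠ 4 := by
      by_contra! hall
      classical
      have := Fintype.ofFinite F
      -- Without such `b`, `q ≤ 3`; as `p` is odd, this forces `m = n = q = 3`.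
      have hsub : (Finset.univ : Finset F) ⊆ {0, 2, -2} := by
        intro b _
        by_cases hb : b = 0
        · simp [hb]
        · have h := hall b hb
          have : (b - 2) * (b + 2) = 0 := by linear_combination h
          rcases mul_eq_zero.mp this with h | h
          · simp [sub_eq_zero.mp h]
          · simp [eq_neg_of_add_eq_zero_left h]
      have hle := (Finset.card_le_card hsub).trans Finset.card_le_three
      rw [Finset.card_univ] at hle
      obtain ⟨k, hk0, hk⟩ := FiniteField.card F p
      have hp3 : 3 ≤ p := by
        have := hp.two_le
        have : p ≠ 2 := by rintro rfl; rw [hmp] at hmo; exact absurd hmo (by decide)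
        omega
      have hpk : p ≤ Fintype.card F := by
        rw [hk]
        exact Nat.le_self_pow k.ne_zero p
      apply h3
      rw [Nat.card_eq_fintype_card]
      omega
    obtain ⟨x, z, hxz⟩ : ∃ x z : F, x ^ 2 + g.1.trace * x * z + z ^ 2 + 1 = b * z := by
      -- Since `c² = 4`, the form is `(x + c z / 2)²`; this `x` kills it, leaving `1 = b z`.
      refine ⟨-(g.1.trace / 2) * b⁻¹, b⁻¹, ?_⟩
      field_simp
      linear_combination -hc
    obtain ⟨A, B, hAB, hA, hB⟩ := exists_mul_eq_companionSL hxz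
    refine reduce ⟨A, B, hAB, exists_pow_eq_of_trace_eq_zero hA hmo, ?_⟩
    rw [hnp]
    exact exists_pow_char_eq_of_trace_sq_ne_four (by rwa [hB])
  · obtain ⟨x, z, hxz⟩ := exists_binary_quadratic_eq_zero h2 hc
    obtain ⟨A, B, hAB, hA, hB⟩ := exists_mul_eq_companionSL (hxz.trans (zero_mul z).symm)
    exact reduce ⟨A, B, hAB, exists_pow_eq_of_trace_eq_zero hA hmo,
      exists_pow_eq_of_trace_eq_zero hB hno⟩

end SpecialLinearGroupTwo

lemma wordMap_powerWord_surjective_iff (m n : ℕ) (G : Type*) [Group G] :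
    Function.Surjective (wordMap (powerWord m n) G) ↔ ∀ g : G, ∃ x y : G, x ^ m * y ^ n = g := by
  refine forall_congr' fun g => ⟨fun ⟨v, hv⟩ => ⟨v 0, v 1, ?_⟩, fun ⟨x, y, h⟩ => ⟨![x, y], ?_⟩⟩
  · simpa [wordMap, powerWord] using hv
  · simpa [wordMap, powerWord] using h

/-! ### The exceptional field of three elements -/

section ThreeElements

/-- The embedding of the quaternion group into `SL₂(𝔽₃)`. -/
def quaternionToSL : QuaternionGroup 2 →* SpecialLinearGroup (Fin 2) (ZMod 3) where
  toFun
    | .a i => ⟨!![0, -1; 1, 0], by decide⟩ ^ i.val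
    | .xa i => ⟨!![1, 1; 1, -1], by decide⟩ * ⟨!![0, -1; 1, 0], by decide⟩ ^ i.val
  map_one' := by decide
  map_mul' := by decide

lemma quaternionToSL_injective : Function.Injective quaternionToSL := by
  decide

lemma coe_range_quaternionToSL :
    (quaternionToSL.range : Set (SpecialLinearGroup (Fin 2) (ZMod 3))) =
      {g | ∃ x : SpecialLinearGroup (Fin 2) (ZMod 3), x ^ 3 = g} := by
  have h1 : ∀ x : SpecialLinearGroup (Fin 2) (ZMod 3), ∃ y, quaternionToSL y = x ^ 3 := by
    decide
  ext g
  constructor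
  · rintro ⟨y, rfl⟩
    refine ⟨quaternionToSL (y ^ 3), ?_⟩
    -- `Q₈` has exponent `4` and `9 ≡ 1` mod `4`, so each element is the cube of its own cube.
    have h9 : ∀ y : QuaternionGroup 2, (y ^ 3) ^ 3 = y := by decide
    rw [← map_pow, h9]
  · rintro ⟨x, rfl⟩
    exact h1 x

lemma card_quaternionToSL_range : Nat.card quaternionToSL.range = 8 := by
  rw [← Nat.card_congr (MonoidHom.ofInjective quaternionToSL_injective).toEquiv,
    Nat.card_eq_fintype_card, QuaternionGroup.card]

lemma exists_ne_pow_three_mul_pow_three : ∃ g : SpecialLinearGroup (Fin 2) (ZMod 3),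
    ∀ x y, x ^ 3 * y ^ 3 ≠ g := by
  obtain ⟨g, hg⟩ : ∃ g, ∀ w, quaternionToSL w ≠ g := by decide
  refine ⟨g, fun x y h => ?_⟩
  have hmem : ∀ z : SpecialLinearGroup (Fin 2) (ZMod 3), z ^ 3 ∈ quaternionToSL.range := by
    intro z
    rw [← SetLike.mem_coe, coe_range_quaternionToSL]
    exact ⟨z, rfl⟩
  obtain ⟨w, hw⟩ := h ▸ mul_mem (hmem x) (hmem y)
  exact hg w hw

lemma not_forall_exists_pow_three_mul_pow_three {F : Type*} [Field F] [Finite F]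
    (hF : Nat.card F = 3) :
    ¬∀ g : SpecialLinearGroup (Fin 2) F, ∃ x y, x ^ 3 * y ^ 3 = g := by
  have := Fintype.ofFinite F
  have : Fact (Nat.Prime 3) := ⟨Nat.prime_three⟩
  rw [Nat.card_eq_fintype_card] at hF
  let e : F ≃+* ZMod 3 := FiniteField.ringEquivOfCardEq (by rw [hF, ZMod.card])
  intro h
  obtain ⟨g, hg⟩ := exists_ne_pow_three_mul_pow_three
  obtain ⟨x, y, hxy⟩ := h (SpecialLinearGroup.map e.symm.toRingHom g)
  apply hg (SpecialLinearGroup.map e.toRingHom x) (SpecialLinearGroup.map e.toRingHom y)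
  rw [← map_pow, ← map_pow, ← map_mul, hxy]
  ext i j
  simp

end ThreeElements

theorem theorem8p9 :
    (∀ (F : Type*) [Field F] [Finite F] (m n q : ℕ),
      m.Prime → Odd m → n.Prime → Odd n → Nat.card F = q → Odd q →
      (Function.Surjective
          (wordMap (powerWord m n) (Matrix.SpecialLinearGroup (Fin 2) F)) ↔
        ¬ (m = 3 ∧ n = 3 ∧ q = 3))) ∧
    (∃ H : Subgroup (Matrix.SpecialLinearGroup (Fin 2) (ZMod 3)),
      (H : Set (Matrix.SpecialLinearGroup (Fin 2) (ZMod 3))) =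
        {g | ∃ x : Matrix.SpecialLinearGroup (Fin 2) (ZMod 3), x ^ 3 = g} ∧
      Nat.card H = 8 ∧
      Nonempty (H ≃* QuaternionGroup 2)) := by
  refine ⟨?_, quaternionToSL.range, coe_range_quaternionToSL, card_quaternionToSL_range,
    ⟨(MonoidHom.ofInjective quaternionToSL_injective).symm⟩⟩
  intro F _ _ m n q hm hmo hn hno hq hqo
  rw [wordMap_powerWord_surjective_iff]
  constructor
  · rintro h ⟨rfl, rfl, rfl⟩
    exact not_forall_exists_pow_three_mul_pow_three hq h
  · intro h3
    subst hq
    refine exists_pow_mul_pow_eq (fun h2 => ?_) hm hmo hn hno h3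
    have := Fintype.ofFinite F
    have hchar : ringChar F = 2 :=
      CharP.ringChar_of_prime_eq_zero Nat.prime_two (by exact_mod_cast h2)
    have := FiniteField.even_card_of_char_two hchar
    rw [Nat.card_eq_fintype_card, Nat.odd_iff] at hqo
    omega
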